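/- Let $n\ge 0$. There are $n$ traders $1,\dots,n$, trader $i$ initially owning good $i$, and trader $k$ ranks all $n$ goods by a permutation $p_k=p_{k1}p_{k2}\cdots p_{kn}$ of $\{1,\dots,n\}$, most preferred good first. An allocation is a permutation $g_1\cdots g_n$ of $\{1,\dots,n\}$ (trader $k$ receives good $g_k$). It is called stable if, for every nonempty set $C$ of traders and every bijection $h\colon C\to C$ such that each trader $k\in C$ either prefers $h_k$ to $g_k$ or has $h_k=g_k$, one has $h_k=g_k$ for all $k\in C$. Then for every choice of the preference lists $p_1,\dots,p_n$ there is exactly one stable allocation $g$. Let $r_k$ be the rank of $g_k$ in the list of trader $k$, i.e. $g_k=p_{kr_k}$, $1\le r_k\le n$. If $p_1,\dots,p_n$ are independent and uniformly random permutations, then for every $z\in\mathbb{C}$ $$E\prod_{k=1}^n(z+r_k)=\prod_{k=1}^n\left(z+\frac{n+1}{n+2-k}\right),$$ and the expected sum of ranks is $$E(r_1+\cdots+r_n)=(n+1)H_n-n,\qquad H_n=\sum_{j=1}^n\frac1j .$$ -/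

import Mathlib

open MeasureTheory ProbabilityTheory

namespace Trading

/-- Preference rankings of `n` traders over the `n` goods (good `i` is initially owned by
trader `i`). The list of trader `k` is `p k 0, p k 1, …, p k (n - 1)`, most preferred first. -/
abbrev Preferences (n : ℕ) : Type := Fin n → Equiv.Perm (Fin n)

/-- The position, counted from `1`, of good `i` in the list of trader `k`. -/
def rank {n : ℕ} (p : Preferences n) (k i : Fin n) : ℕ := ((p k).symm i : ℕ) + 1

/-- `i ≥ j (k)`: trader `k` prefers good `i` to good `j`, or `i = j`. -/
def WeaklyPrefers {n : ℕ} (p : Preferences n) (k i j : Fin n) : Prop :=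
  rank p k i ≤ rank p k j

/-- The allocation `g` (trader `k` gets good `g k`) is stable: if a nonempty coalition `C`
reallocates the goods of its members among its members, by a bijection `h` of `C`, so that no
member is worse off than under `g`, then `h` agrees with `g` on `C`. -/
def IsStable {n : ℕ} (p : Preferences n) (g : Equiv.Perm (Fin n)) : Prop :=
  ∀ C : Finset (Fin n), C.Nonempty → ∀ h : Fin n → Fin n, Set.BijOn h C C →
    (∀ k ∈ C, WeaklyPrefers p k (h k) (g k)) → ∀ k ∈ C, h k = g k

/-- The preference lists `p 0, …, p (n - 1)` are independent random permutations, each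
uniformly distributed over the `n!` permutations (a finite, discrete space). -/
structure IsUniformRandom {Ω : Type*} [MeasurableSpace Ω] (P : Measure Ω) {n : ℕ}
    (p : Fin n → Ω → Equiv.Perm (Fin n)) : Prop where
  measurable : ∀ k, Measurable[_, ⊤] (p k)
  indep : iIndepFun (m := fun _ => ⊤) p P
  uniform : ∀ k (s : Equiv.Perm (Fin n)), P {ω | p k ω = s} = ((n.factorial : ENNReal))⁻¹

end Trading

namespace Trading

/-! Call `g` compatible with a relation `B` if `B` becomes acyclic once the cycles of `g` are
contracted. For `B = Envies p g` this certifies stability, and any stable allocation must equal a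
compatible one, so each `p` has at most one compatible `g`. The rest is double counting of
compatible pairs (p, g). Recording trader k's list by recipients under `g` turns envy into a
relation independent of `g`. By `card_compatible`, its compatible permutations are as numerous as
its linear extensions π. For fixed π the conditions on the lists separate: k must come first, in k's
own list, among the t = n - π k traders from π k onwards (positions from 0). This has probability
1/t and conditional mean position (n+1)/(t+1), which yields the product. With weight 1 the total is
n!^n, the number of preferences, so existence follows by counting, without constructing trading
cycles. -/

open Equiv

/-! ### Transpositions merging and splitting cycles -/

/-- Composing a permutation with a transposition of two points of distinct cycles merges
these cycles. -/
lemma sameCycle_mul_swap {α : Type*} [Fintype α] [DecidableEq α] {g : Perm α} {i j : α}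
    (h : ¬ g.SameCycle i j) : (g * swap i j).SameCycle i j := by
  by_contra hn
  have hgi : (g * swap i j) j = g i := by simp
  -- From `j` the new permutation jumps to `g i` and then follows `g` until it reaches `i`.
  have key : ∀ t : ℕ, (g * swap i j).SameCycle j ((g ^ (t + 1)) i) := by
    intro t
    induction t with
    | zero => rw [zero_add, pow_one, ← hgi]; exact (Perm.SameCycle.refl _ _).apply_right
    | succ t ih =>
      set x := (g ^ (t + 1)) i with hx
      have hxi : x ≠ i := fun e => hn (e ▸ ih).symm
      have hxj : x ≠ j := fun e => h ⟨(t + 1 : ℕ), by rw [zpow_natCast, ← hx, e]⟩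
      have : (g ^ (t + 1 + 1)) i = (g * swap i j) x := by
        rw [pow_succ', Perm.mul_apply, ← hx, Perm.mul_apply, swap_apply_of_ne_of_ne hxi hxj]
      rw [this]
      exact ih.apply_right
  have h1 := key (orderOf g - 1)
  rw [Nat.sub_add_cancel (orderOf_pos g), pow_orderOf_eq_one] at h1
  exact hn h1.symm

/-- Composing a permutation with a transposition of two points of the same cycle splits
this cycle. -/
lemma not_sameCycle_mul_swap {α : Type*} [Fintype α] [DecidableEq α] {g : Perm α} {i j : α}
    (hij : i ≠ j) (h : g.SameCycle i j) : ¬ (g * swap i j).SameCycle i j := by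
  classical
  have hex : ∃ m : ℕ, (g ^ m) i = j := h.exists_nat_pow_eq
  set m := Nat.find hex with hm
  have hmj : (g ^ m) i = j := Nat.find_spec hex
  have hmin : ∀ t < m, (g ^ t) i ≠ j := fun t ht => Nat.find_min hex ht
  have hm0 : 1 ≤ m := by
    rcases Nat.eq_zero_or_pos m with h0 | h0
    · rw [h0] at hmj; exact absurd hmj hij
    · exact h0
  have hne : ∀ t, 1 ≤ t → t ≤ m → (g ^ t) i ≠ i := by
    intro t ht htm e
    refine hmin (m - t) (by omega) ?_
    rw [← hmj]
    conv_rhs => rw [← Nat.sub_add_cancel htm, pow_add, Perm.mul_apply, e]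
  intro hs
  obtain ⟨s, hs⟩ := hs.symm.exists_nat_pow_eq
  -- The new orbit of `j` is trapped in the arc from `g i` to `j`, which avoids `i` by minimality of
  -- `m`.
  have key : ∀ s : ℕ, ∃ t, 1 ≤ t ∧ t ≤ m ∧ ((g * swap i j) ^ s) j = (g ^ t) i := by
    intro s
    induction s with
    | zero => exact ⟨m, hm0, le_rfl, by simp [hmj]⟩
    | succ s ih =>
      obtain ⟨t, ht, htm, e⟩ := ih
      rw [pow_succ', Perm.mul_apply, e]
      rcases htm.eq_or_lt with rfl | hlt
      · exact ⟨1, le_rfl, hm0, by rw [hmj]; simp⟩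
      · refine ⟨t + 1, by omega, hlt, ?_⟩
        rw [Perm.mul_apply, swap_apply_of_ne_of_ne (hne t ht htm) (hmin t hlt), pow_succ',
          Perm.mul_apply]
  obtain ⟨t, ht, htm, e⟩ := key s
  exact hne t ht htm (e ▸ hs)

/-! ### Compatible permutations and linear extensions -/

/-- The relation `B` becomes acyclic (and irreflexive) once the cycles of `g` are contracted:
there is a potential, constant on the cycles of `g`, that decreases along `B`. -/
def Compatible {α : Type*} (B : α → α → Prop) (g : Perm α) : Prop :=
  ∃ φ : α → ℕ, (∀ k, φ (g k) = φ k) ∧ ∀ k l, B k l → φ l < φ k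

/-- The relation `B` with the pair `(a, b)` added. -/
def addEdge {α : Type*} (B : α → α → Prop) (a b : α) : α → α → Prop :=
  fun k l => B k l ∨ (k = a ∧ l = b)

section Compatible

variable {α : Type*} {B : α → α → Prop} {g : Perm α} {i j : α}

lemma Compatible.of_addEdge (h : Compatible (addEdge B i j) g) : Compatible B g := by
  obtain ⟨φ, h1, h2⟩ := h
  exact ⟨φ, h1, fun k l hb => h2 k l (Or.inl hb)⟩

lemma eq_of_sameCycle [Finite α] {φ : α → ℕ} (h : ∀ k, φ (g k) = φ k) (hs : g.SameCycle i j) :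
    φ i = φ j := by
  obtain ⟨t, rfl⟩ := hs.exists_nat_pow_eq
  induction t with
  | zero => rfl
  | succ t ih => rw [pow_succ', Perm.mul_apply, h]; exact ih ⟨t, by simp⟩

lemma Compatible.not_sameCycle [Finite α] (h : Compatible (addEdge B i j) g) :
    ¬ g.SameCycle i j := by
  obtain ⟨φ, h1, h2⟩ := h
  exact fun hs => (h2 i j (Or.inr ⟨rfl, rfl⟩)).ne' (eq_of_sameCycle h1 hs)

lemma compatible_addEdge {φ : α → ℕ} (h1 : ∀ k, φ (g k) = φ k)
    (h2 : ∀ k l, B k l → φ l < φ k) (hs : ¬ g.SameCycle i j) (hle : φ j ≤ φ i) :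
    Compatible (addEdge B i j) g := by
  classical
  -- Doubling leaves room to lift the cycle of `i` by 1, breaking a possible tie with `j` without
  -- reversing any strict inequality.
  refine ⟨fun x => 2 * φ x + if g.SameCycle i x then 1 else 0, fun k => ?_, ?_⟩
  · simp only [h1, Perm.sameCycle_apply_right]
  · rintro k l (hb | ⟨rfl, rfl⟩)
    · have := h2 k l hb
      dsimp only
      split_ifs <;> omega
    · dsimp only
      rw [if_neg hs, if_pos (Perm.SameCycle.refl _ _)]
      omega

variable [DecidableEq α]

lemma apply_mul_swap {φ : α → ℕ} (h : ∀ k, φ (g k) = φ k) (e : φ i = φ j) (k : α) :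
    φ ((g * swap i j) k) = φ k := by
  rw [Perm.mul_apply, h]
  rcases eq_or_ne k i with rfl | hi
  · rw [swap_apply_left, e]
  · rcases eq_or_ne k j with rfl | hj
    · rw [swap_apply_right, e]
    · rw [swap_apply_of_ne_of_ne hi hj]

variable [Fintype α]

/-- Multiplication by a transposition matches the compatible permutations that are not
compatible with either orientation of the extra pair with those compatible with both. -/
lemma compatible_mul_swap_iff (hij : i ≠ j) :
    (Compatible (addEdge B i j) (g * swap i j) ∧ Compatible (addEdge B j i) (g * swap i j)) ↔
      (Compatible B g ∧ ¬ (Compatible (addEdge B i j) g ∨ Compatible (addEdge B j i) g)) := by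
  constructor
  · rintro ⟨c1, c2⟩
    have hs : g.SameCycle i j := by
      have := sameCycle_mul_swap c1.not_sameCycle
      rwa [mul_assoc, swap_mul_self, mul_one] at this
    refine ⟨?_, ?_⟩
    · obtain ⟨φ, h1, h2⟩ := c1
      obtain ⟨ψ, h3, h4⟩ := c2
      obtain ⟨a, ha⟩ := Nat.exists_eq_add_of_lt (h4 j i (Or.inr ⟨rfl, rfl⟩))
      obtain ⟨b, hb⟩ := Nat.exists_eq_add_of_lt (h2 i j (Or.inr ⟨rfl, rfl⟩))
      -- `φ` drops by `b + 1` from `i` to `j` and `ψ` rises by `a + 1`; these weights make the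
      -- combination agree at `i` and `j`, so it survives the transposition.
      refine ⟨fun x => (a + 1) * φ x + (b + 1) * ψ x, ?_, ?_⟩
      · intro k
        have := apply_mul_swap (g := g * swap i j) (i := i) (j := j)
          (φ := fun x => (a + 1) * φ x + (b + 1) * ψ x) (fun k => by simp only [h1, h3])
          (by simp only [ha, hb]; ring) k
        rwa [mul_assoc, swap_mul_self, mul_one] at this
      · intro k l hkl
        have e1 := h2 k l (Or.inl hkl)
        have e2 := h4 k l (Or.inl hkl)
        dsimp only
        gcongr
    · rintro (c | c)
      · exact c.not_sameCycle hs
      · exact c.not_sameCycle hs.symm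
  · rintro ⟨⟨φ, h1, h2⟩, hn⟩
    have hs : g.SameCycle i j := by
      by_contra hs
      apply hn
      rcases le_total (φ j) (φ i) with hle | hle
      · exact Or.inl (compatible_addEdge h1 h2 hs hle)
      · exact Or.inr (compatible_addEdge h1 h2 (fun h => hs h.symm) hle)
    have e := eq_of_sameCycle h1 hs
    have hs' := not_sameCycle_mul_swap hij hs
    exact ⟨compatible_addEdge (apply_mul_swap h1 e) h2 hs' e.ge,
      compatible_addEdge (apply_mul_swap h1 e) h2 (fun h => hs' h.symm) e.le⟩

-- Inclusion–exclusion: the permutations compatible with both orientations, counted twice on the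
-- right, make up for those compatible with `B` but with neither orientation.
open scoped Classical in
lemma card_compatible_addEdge (B : α → α → Prop) (hij : i ≠ j) :
    Fintype.card {g : Perm α // Compatible B g} =
      Fintype.card {g : Perm α // Compatible (addEdge B i j) g} +
      Fintype.card {g : Perm α // Compatible (addEdge B j i) g} := by
  simp only [Fintype.card_subtype]
  rw [← Finset.card_union_add_card_inter, ← Finset.filter_or, ← Finset.filter_and,
    ← Finset.card_filter_add_card_filter_not
      (p := fun g => Compatible (addEdge B i j) g ∨ Compatible (addEdge B j i) g)
      (s := Finset.univ.filter fun g => Compatible B g), Finset.filter_filter,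
    Finset.filter_filter]
  congr 1
  · congr 1
    ext g
    simp only [Finset.mem_filter, Finset.mem_univ, true_and, and_iff_right_iff_imp]
    rintro (h | h) <;> exact h.of_addEdge
  · refine Finset.card_bij (fun g _ => g * swap i j) ?_ ?_ ?_
    · intro g hg
      simp only [Finset.mem_filter, Finset.mem_univ, true_and] at hg ⊢
      exact (compatible_mul_swap_iff hij).2 hg
    · intro g _ g' _ h
      exact mul_right_cancel h
    · intro g hg
      simp only [Finset.mem_filter, Finset.mem_univ, true_and] at hg
      refine ⟨g * swap i j, ?_, by rw [mul_assoc, swap_mul_self, mul_one]⟩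
      simp only [Finset.mem_filter, Finset.mem_univ, true_and]
      rw [← compatible_mul_swap_iff hij, mul_assoc, swap_mul_self, mul_one]
      exact hg

end Compatible

/-- The ordering `π` is a linear extension of `B`. -/
def IsLinearExtension {n : ℕ} (B : Fin n → Fin n → Prop) (π : Perm (Fin n)) : Prop :=
  ∀ k l, B k l → π l < π k

open scoped Classical in
lemma card_isLinearExtension_addEdge {n : ℕ} (B : Fin n → Fin n → Prop) {i j : Fin n}
    (hij : i ≠ j) :
    Fintype.card {π // IsLinearExtension B π} =
      Fintype.card {π // IsLinearExtension (addEdge B i j) π} +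
      Fintype.card {π // IsLinearExtension (addEdge B j i) π} := by
  have h : ∀ a b π, IsLinearExtension (addEdge B a b) π ↔ IsLinearExtension B π ∧ π b < π a := by
    intro a b π
    constructor
    · exact fun h => ⟨fun k l hb => h k l (Or.inl hb), h a b (Or.inr ⟨rfl, rfl⟩)⟩
    · rintro ⟨h1, h2⟩ k l (hb | ⟨rfl, rfl⟩)
      exacts [h1 k l hb, h2]
  simp only [Fintype.card_subtype, h]
  rw [← Finset.card_filter_add_card_filter_not (p := fun π : Perm (Fin n) => π j < π i),
    Finset.filter_filter, Finset.filter_filter]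
  congr 2
  ext π
  have : π i ≠ π j := fun e => hij (π.injective e)
  simp only [Finset.mem_filter, Finset.mem_univ, true_and, and_congr_right_iff]
  intro _
  omega

lemma compatible_one_of_isLinearExtension {n : ℕ} {B : Fin n → Fin n → Prop} {π : Perm (Fin n)}
    (h : IsLinearExtension B π) : Compatible B 1 :=
  ⟨fun k => π k, fun _ => rfl, fun k l hb => h k l hb⟩

lemma IsLinearExtension.unique {n : ℕ} {B : Fin n → Fin n → Prop}
    (hB : ∀ i j, i ≠ j → B i j ∨ B j i) {π π' : Perm (Fin n)}
    (h : IsLinearExtension B π) (h' : IsLinearExtension B π') : π = π' := by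
  have hm : StrictMono (π.symm.trans π') := by
    intro a b hab
    have hne : π.symm a ≠ π.symm b := fun e => hab.ne (π.symm.injective e)
    rcases hB _ _ hne with hb | hb
    · have := h _ _ hb
      simp only [apply_symm_apply] at this
      exact absurd this hab.not_gt
    · exact h' _ _ hb
  have hid : StrictMono.orderIsoOfSurjective _ hm (Equiv.surjective _) = OrderIso.refl _ :=
    Subsingleton.elim _ _
  ext k
  have := congrArg (fun e : Fin n ≃o Fin n => e (π k)) hid
  simp at this
  rw [this]

-- When all pairs are comparable, either `B` has a cycle and both counts are 0, or it is a strict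
-- total order and only the identity and one ordering qualify.
open scoped Classical in
lemma card_compatible_of_total {n : ℕ} {B : Fin n → Fin n → Prop}
    (hB : ∀ i j, i ≠ j → B i j ∨ B j i) :
    Fintype.card {g // Compatible B g} = Fintype.card {π // IsLinearExtension B π} := by
  by_cases hc : ∃ g, Compatible B g
  · have hone : ∀ g, Compatible B g → g = 1 := by
      rintro g ⟨φ, h1, h2⟩
      ext k
      by_contra hne
      have hne' : g k ≠ k := fun e => hne (by rw [e]; rfl)
      rcases hB _ _ hne' with hb | hb
      · exact (h2 _ _ hb).ne (h1 k).symm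
      · exact (h2 _ _ hb).ne (h1 k)
    obtain ⟨π, hπ⟩ : ∃ π, IsLinearExtension B π := by
      obtain ⟨g, φ, h1, h2⟩ := hc
      refine ⟨(Tuple.sort φ).symm, fun k l hb => ?_⟩
      by_contra hle
      have := Tuple.monotone_sort φ (not_lt.1 hle)
      simp only [Function.comp_apply, apply_symm_apply] at this
      exact absurd (h2 k l hb) this.not_gt
    have c1 : Fintype.card {g // Compatible B g} = 1 :=
      Fintype.card_eq_one_iff.2 ⟨⟨1, compatible_one_of_isLinearExtension hπ⟩,
        fun g => Subtype.ext (hone _ g.2)⟩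
    have c2 : Fintype.card {π // IsLinearExtension B π} = 1 :=
      Fintype.card_eq_one_iff.2 ⟨⟨π, hπ⟩, fun g => Subtype.ext (g.2.unique hB hπ)⟩
    rw [c1, c2]
  · have : IsEmpty {g // Compatible B g} := ⟨fun g => hc ⟨_, g.2⟩⟩
    have : IsEmpty {π // IsLinearExtension B π} :=
      ⟨fun π => hc ⟨1, compatible_one_of_isLinearExtension π.2⟩⟩
    rw [Fintype.card_eq_zero, Fintype.card_eq_zero]

open scoped Classical in
/-- There are as many permutations compatible with `B` as linear extensions of `B`. -/
theorem card_compatible {n : ℕ} (B : Fin n → Fin n → Prop) :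
    Fintype.card {g // Compatible B g} = Fintype.card {π // IsLinearExtension B π} := by
  -- Both counts obey the same recursion under orienting an incomparable pair, so induct on the
  -- number of such pairs.
  induction hN : (Finset.univ.filter fun x : Fin n × Fin n =>
      x.1 ≠ x.2 ∧ ¬ (B x.1 x.2 ∨ B x.2 x.1)).card using Nat.strong_induction_on generalizing B with
  | _ N ih =>
  by_cases hB : ∀ i j, i ≠ j → B i j ∨ B j i
  · exact card_compatible_of_total hB
  · push Not at hB
    obtain ⟨i, j, hij, h1, h2⟩ := hB
    rw [card_compatible_addEdge B hij, card_isLinearExtension_addEdge B hij]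
    have key : ∀ a b, a ≠ b → ¬ B a b → ¬ B b a →
        Fintype.card {g // Compatible (addEdge B a b) g} =
          Fintype.card {π // IsLinearExtension (addEdge B a b) π} := by
      intro a b hab h1 h2
      refine ih _ ?_ _ rfl
      rw [← hN]
      apply Finset.card_lt_card
      rw [Finset.ssubset_iff_of_subset]
      · refine ⟨(a, b), ?_, ?_⟩
        · simp [hab, h1, h2]
        · simp [addEdge]
      · intro x hx
        simp only [Finset.mem_filter, Finset.mem_univ, true_and] at hx ⊢
        simp only [addEdge] at hx
        tauto
    rw [key i j hij h1 h2, key j i hij.symm h2 h1]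

/-! ### Stability through potentials -/

variable {n : ℕ}

lemma rank_injective (p : Preferences n) (k : Fin n) : Function.Injective (rank p k) := by
  intro i j h
  simp only [rank] at h
  exact (p k).symm.injective (Fin.ext (by omega))

/-- Trader `k` prefers the good that `l` receives under `g` to the own one. -/
def Envies (p : Preferences n) (g : Perm (Fin n)) (k l : Fin n) : Prop :=
  rank p k (g l) < rank p k (g k)

lemma lt_of_rank_lt {p : Preferences n} {g : Perm (Fin n)} {φ : Fin n → ℕ}
    (h1 : ∀ k, φ (g k) = φ k) (h2 : ∀ k l, Envies p g k l → φ l < φ k) {k i : Fin n}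
    (h : rank p k i < rank p k (g k)) : φ i < φ k := by
  have := h2 k (g.symm i) (by rwa [Envies, apply_symm_apply])
  rwa [← h1, apply_symm_apply] at this

lemma isStable_of_compatible {p : Preferences n} {g : Perm (Fin n)}
    (hc : Compatible (Envies p g) g) : IsStable p g := by
  obtain ⟨φ, h1, h2⟩ := hc
  intro C _ h hC hw
  have hle : ∀ k ∈ C, φ (h k) ≤ φ k := by
    intro k hk
    rcases (hw k hk).lt_or_eq with hlt | heq
    · exact (lt_of_rank_lt h1 h2 hlt).le
    · rw [rank_injective p k heq, h1]
  -- Along `h` the potential never rises, yet its sum over `C` is preserved; a strict improvement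
  -- would be a strict drop.
  have hsum : ∑ k ∈ C, φ (h k) = ∑ k ∈ C, φ k :=
    Finset.sum_nbij h (fun k hk => hC.mapsTo hk) hC.injOn hC.surjOn fun _ _ => rfl
  intro k hk
  rcases (hw k hk).lt_or_eq with hlt | heq
  · exact absurd ((Finset.sum_eq_sum_iff_of_le hle).1 hsum k hk) (lt_of_rank_lt h1 h2 hlt).ne
  · exact rank_injective p k heq

/-- Each level set of the potential is a coalition that can reallocate by `g`. Anything its members
like better than `g` lies at a lower level, where by induction `g'` already hands it to someone
else; hence stability of `g'` forces agreement. -/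
lemma eq_of_compatible_of_isStable {p : Preferences n} {g g' : Perm (Fin n)}
    (hc : Compatible (Envies p g) g) (hs : IsStable p g') : g = g' := by
  obtain ⟨φ, h1, h2⟩ := hc
  have key : ∀ c k, φ k = c → g k = g' k := by
    intro c
    induction c using Nat.strong_induction_on with
    | _ c ih =>
    intro k hk
    refine hs (Finset.univ.filter fun k => φ k = c) ⟨k, by simp [hk]⟩ g ⟨?_, g.injective.injOn, ?_⟩
      ?_ k (by simp [hk])
    · intro x hx
      simpa [h1] using hx
    · intro x hx
      refine ⟨g.symm x, ?_, by simp⟩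
      have := h1 (g.symm x)
      rw [apply_symm_apply] at this
      simpa [← this] using hx
    · intro x hx
      have hx : φ x = c := by simpa using hx
      rw [WeaklyPrefers]
      by_contra hlt
      have hlt' := lt_of_rank_lt h1 h2 (not_le.1 hlt)
      rw [hx] at hlt'
      have h3 : φ (g.symm (g' x)) = φ (g' x) := by
        rw [← h1 (g.symm (g' x)), apply_symm_apply]
      have h4 := ih _ hlt' (g.symm (g' x)) h3
      rw [apply_symm_apply] at h4
      have h5 := g'.injective h4
      rw [← h5] at h3
      omega
  ext k
  rw [key _ k rfl]

/-! ### Averages over one list -/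

/-- The number of orderings in which `k` comes first among the elements of `T`. -/
lemma card_first_mul (T : Finset (Fin n)) {k : Fin n} (hk : k ∈ T) :
    (Finset.univ.filter fun σ : Perm (Fin n) => ∀ j ∈ T, σ k ≤ σ j).card * T.card =
      n.factorial := by
  have hswap : ∀ l ∈ T, (Finset.univ.filter fun σ : Perm (Fin n) => ∀ j ∈ T, σ l ≤ σ j).card =
      (Finset.univ.filter fun σ : Perm (Fin n) => ∀ j ∈ T, σ k ≤ σ j).card := by
    intro l hl
    have hmem : ∀ j ∈ T, swap k l j ∈ T := by
      intro j hj
      rw [swap_apply_def]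
      split_ifs <;> assumption
    refine Finset.card_bij (fun σ _ => σ * swap k l) ?_ (fun _ _ _ _ h => mul_right_cancel h) ?_
    · intro σ hσ
      simp only [Finset.mem_filter, Finset.mem_univ, true_and] at hσ ⊢
      intro j hj
      simpa using hσ _ (hmem j hj)
    · intro σ hσ
      simp only [Finset.mem_filter, Finset.mem_univ, true_and] at hσ
      refine ⟨σ * swap k l, ?_, by rw [mul_assoc, swap_mul_self, mul_one]⟩
      simp only [Finset.mem_filter, Finset.mem_univ, true_and]
      intro j hj
      simpa using hσ _ (hmem j hj)
  have huniv : (Finset.univ : Finset (Perm (Fin n))) =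
      T.biUnion fun l => Finset.univ.filter fun σ : Perm (Fin n) => ∀ j ∈ T, σ l ≤ σ j := by
    ext σ
    obtain ⟨l, hl, hl'⟩ := T.exists_min_image σ ⟨k, hk⟩
    simp only [Finset.mem_univ, Finset.mem_biUnion, Finset.mem_filter, true_and, true_iff]
    exact ⟨l, hl, hl'⟩
  have hcard : (Finset.univ : Finset (Perm (Fin n))).card = n.factorial := by
    rw [Finset.card_univ, Fintype.card_perm, Fintype.card_fin]
  have h := congrArg Finset.card huniv
  rw [hcard, Finset.card_biUnion, Finset.sum_congr rfl hswap, Finset.sum_const,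
    smul_eq_mul] at h
  · rw [h, mul_comm]
  intro l hl m hm hlm
  rw [Function.onFun, Finset.disjoint_left]
  intro σ h1 h2
  simp only [Finset.mem_filter, Finset.mem_univ, true_and] at h1 h2
  exact hlm (σ.injective ((h1 m hm).antisymm (h2 l hl)))

lemma card_first_eq_div (T : Finset (Fin n)) {k : Fin n} (hk : k ∈ T) :
    ((Finset.univ.filter fun σ : Perm (Fin n) => ∀ j ∈ T, σ k ≤ σ j).card : ℂ) =
      n.factorial / T.card := by
  have h0 : (T.card : ℂ) ≠ 0 := by
    exact_mod_cast (Finset.card_pos.2 ⟨k, hk⟩).ne'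
  rw [eq_div_iff h0]
  exact_mod_cast card_first_mul T hk

/-- The sum of the positions of `k` over the orderings in which `k` comes first in `T`. -/
lemma sum_position_first (T : Finset (Fin n)) {k : Fin n} (hk : k ∈ T) :
    ∑ σ : Perm (Fin n) with ∀ j ∈ T, σ k ≤ σ j, (((σ k : ℕ) : ℂ) + 1) =
      n.factorial / T.card * ((n + 1) / (T.card + 1)) := by
  have h0 : (T.card : ℂ) ≠ 0 := by
    exact_mod_cast (Finset.card_pos.2 ⟨k, hk⟩).ne'
  have h1 : (T.card : ℂ) + 1 ≠ 0 := Nat.cast_add_one_ne_zero _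
  have hpos : ∀ σ : Perm (Fin n), (∀ j ∈ T, σ k ≤ σ j) →
      ((σ k : ℕ) : ℂ) = ∑ j ∈ Tᶜ, if σ j < σ k then 1 else 0 := by
    intro σ hσ
    rw [Finset.sum_boole]
    congr 1
    rw [← Fin.card_Iio]
    refine (Finset.card_bij (fun j _ => σ j) ?_ (fun _ _ _ _ h => σ.injective h) ?_).symm
    · intro j hj
      simpa using (Finset.mem_filter.1 hj).2
    · intro a ha
      have ha := Finset.mem_Iio.1 ha
      refine ⟨σ.symm a, ?_, by simp⟩
      rw [Finset.mem_filter, Finset.mem_compl, apply_symm_apply]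
      refine ⟨fun hT => ?_, ha⟩
      have := hσ _ hT
      rw [apply_symm_apply] at this
      exact absurd ha this.not_gt
  -- Here `k` is first in `T` but not in `insert j T`, so the count is a difference.
  have hj : ∀ j ∈ Tᶜ, ∑ σ : Perm (Fin n) with ∀ j ∈ T, σ k ≤ σ j,
      (if σ j < σ k then 1 else 0 : ℂ) =
        n.factorial / T.card - n.factorial / (T.card + 1) := by
    intro j hj
    have hjT := Finset.mem_compl.1 hj
    have e := card_first_eq_div (insert j T) (Finset.mem_insert_of_mem hk)
    rw [Finset.card_insert_of_notMem hjT] at e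
    push_cast at e
    rw [← card_first_eq_div T hk, ← e, Finset.sum_boole, eq_sub_iff_add_eq, ← Nat.cast_add]
    congr 1
    refine Eq.trans ?_
      (Finset.card_filter_add_card_filter_not (p := fun σ : Perm (Fin n) => σ j < σ k))
    congr 1
    rw [Finset.filter_filter]
    congr 1
    ext σ
    simp only [Finset.mem_filter, Finset.mem_univ, true_and, Finset.forall_mem_insert, not_lt]
    tauto
  rw [Finset.sum_add_distrib, Finset.sum_congr rfl fun σ hσ => hpos σ (Finset.mem_filter.1 hσ).2,
    Finset.sum_comm, Finset.sum_congr rfl hj, Finset.sum_const, Finset.sum_const, nsmul_one,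
    card_first_eq_div T hk, Finset.card_compl, Fintype.card_fin, nsmul_eq_mul,
    Nat.cast_sub (by simpa using T.card_le_univ)]
  field_simp
  ring

lemma sum_add_position_first (T : Finset (Fin n)) {k : Fin n} (hk : k ∈ T) (z : ℂ) :
    ∑ σ : Perm (Fin n) with ∀ j ∈ T, σ k ≤ σ j, (z + (((σ k : ℕ) + 1 : ℕ) : ℂ)) =
      n.factorial / T.card * (z + (n + 1) / (T.card + 1)) := by
  push_cast
  rw [Finset.sum_add_distrib, sum_position_first T hk, Finset.sum_const, nsmul_eq_mul,
    card_first_eq_div T hk]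
  ring

/-! ### Double counting of preferences and allocations -/

open scoped Classical in
/-- The sum, over all preferences, of a symmetric weight of the compatible allocations
equals the corresponding sum for serial dictatorships. -/
lemma sum_sum_compatible (w : ℕ → ℂ) :
    ∑ p : Preferences n, ∑ g : Perm (Fin n) with Compatible (Envies p g) g,
        ∏ k, w (rank p k (g k)) =
      ∑ π : Perm (Fin n), ∏ k, ∑ σ : Perm (Fin n) with
        ∀ j ∈ Finset.univ.filter (fun j => π k ≤ π j), σ k ≤ σ j, w ((σ k : ℕ) + 1) := by
  let B : (Fin n → Perm (Fin n)) → Fin n → Fin n → Prop := fun σ k l => σ k l < σ k k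
  have hg : ∀ g : Perm (Fin n), (∑ p : Preferences n,
      if Compatible (Envies p g) g then ∏ k, w (rank p k (g k)) else 0) =
      ∑ σ : Fin n → Perm (Fin n),
        if Compatible (B σ) g then ∏ k, w ((σ k k : ℕ) + 1) else 0 := by
    intro g
    -- `σ k l` is the position in trader `k`'s list of the good that `l` receives.
    refine Fintype.sum_equiv ⟨fun p k => g.trans (p k).symm, fun σ k => (σ k).symm.trans g,
      fun p => ?_, fun σ => ?_⟩ _ _ fun p => ?_
    · funext k; ext; simp
    · funext k; ext; simp
    · have : Envies p g = B fun k => g.trans (p k).symm := by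
        funext k l
        simp [Envies, rank, B]
      rw [this]
      rfl
  have hπ : ∀ π : Perm (Fin n), (∑ σ : Fin n → Perm (Fin n),
      if IsLinearExtension (B σ) π then ∏ k, w ((σ k k : ℕ) + 1) else 0) =
      ∏ k, ∑ σ : Perm (Fin n) with
        ∀ j ∈ Finset.univ.filter (fun j => π k ≤ π j), σ k ≤ σ j, w ((σ k : ℕ) + 1) := by
    intro π
    simp only [Finset.sum_filter]
    rw [Finset.prod_univ_sum, Fintype.piFinset_univ]
    refine Finset.sum_congr rfl fun σ _ => ?_
    rw [Finset.prod_ite_zero]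
    congr 1
    simp only [IsLinearExtension, B, Finset.mem_filter, Finset.mem_univ, true_and, true_imp_iff,
      eq_iff_iff]
    refine forall_congr' fun k => forall_congr' fun l => ?_
    rw [← not_le, ← not_le, not_imp_not]
  simp only [Finset.sum_filter] at hπ ⊢
  rw [Finset.sum_comm, Finset.sum_congr rfl fun g _ => hg g, Finset.sum_comm]
  refine Eq.trans ?_ (Finset.sum_comm.trans (Finset.sum_congr rfl fun π _ => hπ π))
  refine Finset.sum_congr rfl fun σ _ => ?_
  rw [← Finset.sum_filter, ← Finset.sum_filter, Finset.sum_const, Finset.sum_const,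
    ← Fintype.card_subtype, ← Fintype.card_subtype, card_compatible]

lemma card_filter_le_apply (π : Perm (Fin n)) (k : Fin n) :
    (Finset.univ.filter (fun j => π k ≤ π j)).card = n - π k := by
  rw [← Fin.card_Ici]
  refine Finset.card_bij (fun j _ => π j) (fun j hj => ?_) (fun _ _ _ _ h => π.injective h) ?_
  · simpa using hj
  · intro a ha
    exact ⟨π.symm a, by simpa using ha, by simp⟩

lemma prod_factorial_div (n : ℕ) :
    ∏ a : Fin n, ((n.factorial : ℂ) / ((n - a : ℕ) : ℂ)) =
      (n.factorial : ℂ) ^ n / n.factorial := by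
  rw [Finset.prod_div_distrib, Finset.prod_const, Finset.card_univ, Fintype.card_fin,
    Fin.prod_univ_eq_prod_range (fun a => ((n - a : ℕ) : ℂ)) n]
  congr 1
  rw [← Finset.prod_range_reflect, ← Finset.prod_range_add_one_eq_factorial, Nat.cast_prod]
  refine Finset.prod_congr rfl fun a ha => ?_
  have := Finset.mem_range.1 ha
  congr 1
  omega

open scoped Classical in
lemma sum_sum_compatible_prod_add (z : ℂ) :
    ∑ p : Preferences n, ∑ g : Perm (Fin n) with Compatible (Envies p g) g,
        ∏ k, (z + (rank p k (g k) : ℂ)) =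
      (n.factorial : ℂ) ^ n * ∏ a : Fin n, (z + (n + 1) / ((n - a : ℕ) + 1)) := by
  rw [sum_sum_compatible fun r => z + (r : ℂ)]
  have h0 : (n.factorial : ℂ) ≠ 0 := by exact_mod_cast n.factorial_ne_zero
  have : ∀ π : Perm (Fin n), ∏ k, ∑ σ : Perm (Fin n) with
      ∀ j ∈ Finset.univ.filter (fun j => π k ≤ π j), σ k ≤ σ j, (z + (((σ k : ℕ) + 1 : ℕ) : ℂ)) =
      (n.factorial : ℂ) ^ n / n.factorial *
        ∏ a : Fin n, (z + (n + 1) / ((n - a : ℕ) + 1)) := by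
    intro π
    rw [← prod_factorial_div, ← Finset.prod_mul_distrib]
    refine Eq.trans ?_ (Equiv.prod_comp π _)
    refine Finset.prod_congr rfl fun k _ => ?_
    rw [← card_filter_le_apply, ← sum_add_position_first _ (k := k) (by simp) z]
  rw [Finset.sum_congr rfl fun π _ => this π, Finset.sum_const, Finset.card_univ,
    Fintype.card_perm, Fintype.card_fin, nsmul_eq_mul]
  field_simp

open scoped Classical in
lemma sum_card_compatible :
    ∑ p : Preferences n, (Finset.univ.filter fun g => Compatible (Envies p g) g).card =
      n.factorial ^ n := by
  have h := sum_sum_compatible (n := n) fun _ => 1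
  simp only [Finset.prod_const_one, Finset.sum_const, nsmul_one] at h
  have h0 : (n.factorial : ℂ) ≠ 0 := by exact_mod_cast n.factorial_ne_zero
  have : ∀ π : Perm (Fin n), ∏ k, ((Finset.univ.filter fun σ : Perm (Fin n) =>
      ∀ j ∈ Finset.univ.filter (fun j => π k ≤ π j), σ k ≤ σ j).card : ℂ) =
      (n.factorial : ℂ) ^ n / n.factorial := by
    intro π
    rw [← prod_factorial_div]
    refine Eq.trans ?_ (Equiv.prod_comp π _)
    refine Finset.prod_congr rfl fun k _ => ?_
    rw [← card_filter_le_apply, card_first_eq_div _ (by simp)]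
  rw [Finset.sum_congr rfl fun π _ => this π, Finset.sum_const, Finset.card_univ,
    Fintype.card_perm, Fintype.card_fin, nsmul_eq_mul, mul_div_cancel₀ _ h0] at h
  exact_mod_cast h

/-! ### Existence, uniqueness and rank sums -/

lemma card_preferences (n : ℕ) : Fintype.card (Preferences n) = n.factorial ^ n := by
  simp [Preferences, Fintype.card_perm]

lemma exists_compatible (p : Preferences n) : ∃ g, Compatible (Envies p g) g := by
  classical
  by_contra hn
  have hle : ∀ p : Preferences n,
      (Finset.univ.filter fun g => Compatible (Envies p g) g).card ≤ 1 := by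
    intro p
    rw [Finset.card_le_one]
    intro a ha b hb
    exact eq_of_compatible_of_isStable (Finset.mem_filter.1 ha).2
      (isStable_of_compatible (Finset.mem_filter.1 hb).2)
  have hlt : ∑ p : Preferences n, (Finset.univ.filter fun g => Compatible (Envies p g) g).card <
      ∑ _p : Preferences n, 1 := by
    refine Finset.sum_lt_sum (fun p _ => hle p) ⟨p, Finset.mem_univ _, ?_⟩
    rw [Nat.lt_one_iff, Finset.card_eq_zero, Finset.filter_eq_empty_iff]
    exact fun g _ hg => hn ⟨g, hg⟩
  rw [sum_card_compatible, Finset.sum_const, Finset.card_univ, card_preferences, smul_eq_mul,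
    mul_one] at hlt
  exact hlt.false

theorem isStable_iff_compatible {p : Preferences n} {g : Perm (Fin n)} :
    IsStable p g ↔ Compatible (Envies p g) g := by
  refine ⟨fun hs => ?_, isStable_of_compatible⟩
  obtain ⟨g', hg'⟩ := exists_compatible p
  rwa [← eq_of_compatible_of_isStable hg' hs]

theorem existsUnique_isStable (p : Preferences n) : ∃! g, IsStable p g := by
  obtain ⟨g, hg⟩ := exists_compatible p
  exact ⟨g, isStable_of_compatible hg, fun g' hg' => (eq_of_compatible_of_isStable hg hg').symm⟩

/-- The stable allocation of given preferences. -/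
noncomputable def stableAllocation (p : Preferences n) : Perm (Fin n) :=
  (existsUnique_isStable p).choose

lemma isStable_iff_eq {p : Preferences n} {g : Perm (Fin n)} :
    IsStable p g ↔ g = stableAllocation p :=
  ⟨fun h => (existsUnique_isStable p).choose_spec.2 g h,
    fun h => h ▸ (existsUnique_isStable p).choose_spec.1⟩

theorem sum_prod_add_rank (z : ℂ) :
    ∑ p : Preferences n, ∏ k, (z + (rank p k (stableAllocation p k) : ℂ)) =
      (n.factorial : ℂ) ^ n * ∏ k ∈ Finset.Icc 1 n, (z + (n + 1) / (n + 2 - k)) := by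
  classical
  have := sum_sum_compatible_prod_add (n := n) z
  simp only [← isStable_iff_compatible, isStable_iff_eq, Finset.filter_eq', Finset.mem_univ,
    if_true, Finset.sum_singleton] at this
  rw [this, Fin.prod_univ_eq_prod_range (fun a => z + ((n : ℂ) + 1) / ((n - a : ℕ) + 1)) n,
    Finset.range_eq_Ico, Finset.prod_Ico_eq_prod_range]
  congr 1
  rw [← Finset.Ico_add_one_right_eq_Icc, Finset.prod_Ico_eq_prod_range]
  refine Finset.prod_congr (by simp) fun a ha => ?_
  have ha := Finset.mem_range.1 ha
  rw [Nat.cast_sub (by omega)]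
  push_cast
  ring_nf

lemma coeff_prod_X_add_C_sub_one {ι R : Type*} [CommSemiring R] {s : Finset ι} (hs : s.Nonempty)
    (r : ι → R) :
    (∏ i ∈ s, (Polynomial.X + Polynomial.C (r i))).coeff (s.card - 1) = ∑ i ∈ s, r i := by
  have := hs.card_pos
  rw [Finset.prod_X_add_C_coeff _ _ (Nat.sub_le _ _), Nat.sub_sub_self this,
    Finset.powersetCard_one]
  simp

theorem sum_sum_rank :
    ∑ p : Preferences n, ∑ k, (rank p k (stableAllocation p k) : ℂ) =
      (n.factorial : ℂ) ^ n * ∑ k ∈ Finset.Icc 1 n, ((n : ℂ) + 1) / (n + 2 - k) := by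
  -- The rank sum is read off as the coefficient of degree `n - 1`, which needs `n` positive.
  rcases Nat.eq_zero_or_pos n with rfl | hn
  · simp
  open Polynomial in
  have hpoly : ∑ p : Preferences n, ∏ k, (X + C (rank p k (stableAllocation p k) : ℂ)) =
      C ((n.factorial : ℂ) ^ n) * ∏ k ∈ Finset.Icc 1 n, (X + C (((n : ℂ) + 1) / (n + 2 - k))) := by
    refine Polynomial.funext fun z => ?_
    simpa [eval_finsetSum, eval_prod] using sum_prod_add_rank (n := n) z
  have h := congrArg (fun q => Polynomial.coeff q (n - 1)) hpoly
  have h1 := coeff_prod_X_add_C_sub_one (Finset.nonempty_Icc.2 hn)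
    fun k : ℕ => ((n : ℂ) + 1) / (n + 2 - k)
  rw [Nat.card_Icc, Nat.add_sub_cancel] at h1
  have h2 : ∀ r : Fin n → ℂ, (∏ k, (Polynomial.X + Polynomial.C (r k))).coeff (n - 1) =
      ∑ k, r k := by
    intro r
    have := coeff_prod_X_add_C_sub_one (s := (Finset.univ : Finset (Fin n))) ⟨⟨0, hn⟩, by simp⟩ r
    rwa [Finset.card_univ, Fintype.card_fin] at this
  simp only [Polynomial.finsetSum_coeff, Polynomial.coeff_C_mul, h1, h2] at h
  exact h

/-- The denominators run over 2, …, n+1, giving (n+1)(H_{n+1} - 1). -/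
lemma sum_Icc_div_eq_harmonic (n : ℕ) :
    ∑ k ∈ Finset.Icc 1 n, ((n : ℝ) + 1) / (n + 2 - k) = (n + 1) * (harmonic n : ℝ) - n := by
  have h : ∑ k ∈ Finset.Icc 1 n, ((n : ℝ) + 1) / (n + 2 - k) =
      (n + 1) * ∑ j ∈ Finset.range n, ((j : ℝ) + 1 + 1)⁻¹ := by
    rw [← Finset.sum_range_reflect, Finset.mul_sum, ← Finset.Ico_add_one_right_eq_Icc,
      Finset.sum_Ico_eq_sum_range]
    refine Finset.sum_congr (by simp) fun a ha => ?_
    have ha : a < n := by simpa using ha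
    rw [Nat.sub_sub, Nat.cast_sub (by omega), div_eq_mul_inv]
    push_cast
    ring_nf
  have h2 : (harmonic (n + 1) : ℝ) = ∑ j ∈ Finset.range n, ((j : ℝ) + 1 + 1)⁻¹ + 1 := by
    rw [harmonic, Finset.sum_range_succ']
    push_cast
    simp
  have h3 : (harmonic (n + 1) : ℝ) = harmonic n + ((n : ℝ) + 1)⁻¹ := by
    rw [harmonic_succ]
    push_cast
    rfl
  have h4 : (n : ℝ) + 1 ≠ 0 := by positivity
  rw [h, eq_sub_of_add_eq h2.symm, h3]
  field_simp
  ring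

/-! ### From averages to expectations -/

/-- Expectations of functions of uniformly random preferences are averages. -/
lemma IsUniformRandom.integral_eq {Ω : Type*} [MeasurableSpace Ω] {P : Measure Ω}
    [IsProbabilityMeasure P] {n : ℕ} {p : Fin n → Ω → Equiv.Perm (Fin n)}
    (hp : IsUniformRandom P p) {E : Type*} [NormedAddCommGroup E] [NormedSpace ℝ E]
    [CompleteSpace E] (F : Preferences n → E) :
    Integrable (fun ω => F fun k => p k ω) P ∧
      ∫ ω, F (fun k => p k ω) ∂P = ((n.factorial : ℝ) ^ n)⁻¹ • ∑ q, F q := by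
  let : MeasurableSpace (Preferences n) := ⊤
  have : DiscreteMeasurableSpace (Preferences n) := ⟨fun _ => trivial⟩
  have hpre : ∀ q : Preferences n, (fun ω k => p k ω) ⁻¹' {q} =
      ⋂ k ∈ (Finset.univ : Finset (Fin n)), p k ⁻¹' {q k} := by
    intro q
    ext ω
    simp [funext_iff]
  have hmeas : Measurable fun ω k => p k ω := by
    refine measurable_to_countable' fun q => ?_
    rw [hpre]
    exact Finset.measurableSet_biInter _ fun k _ => hp.measurable k trivial
  have hF : StronglyMeasurable F := .of_discrete
  have hprob : IsProbabilityMeasure (P.map fun ω k => p k ω) :=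
    Measure.isProbabilityMeasure_map hmeas.aemeasurable
  have hint : Integrable F (P.map fun ω k => p k ω) := .of_finite
  refine ⟨hint.comp_measurable hmeas, ?_⟩
  rw [← integral_map hmeas.aemeasurable hF.aestronglyMeasurable, integral_fintype hint,
    Finset.smul_sum]
  refine Finset.sum_congr rfl fun q _ => ?_
  congr 1
  rw [measureReal_def, Measure.map_apply hmeas trivial, hpre,
    hp.indep.measure_inter_preimage_eq_mul Finset.univ (fun _ _ => trivial)]
  have : ∀ k, P (p k ⁻¹' {q k}) = ((n.factorial : ENNReal))⁻¹ := fun k => hp.uniform k (q k)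
  simp [this]

end Trading

theorem mainTheorem3 {Ω : Type*} [MeasurableSpace Ω] (P : Measure Ω) [IsProbabilityMeasure P]
    (n : ℕ) (p : Fin n → Ω → Equiv.Perm (Fin n)) (hp : Trading.IsUniformRandom P p) :
    (∀ q : Trading.Preferences n, ∃! g : Equiv.Perm (Fin n), Trading.IsStable q g) ∧
    ∀ g : Ω → Equiv.Perm (Fin n), (∀ ω, Trading.IsStable (fun k => p k ω) (g ω)) →
      (∀ z : ℂ,
        Integrable (fun ω => ∏ k, (z + (Trading.rank (fun k => p k ω) k (g ω k) : ℂ))) P ∧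
        ∫ ω, ∏ k, (z + (Trading.rank (fun k => p k ω) k (g ω k) : ℂ)) ∂P =
          ∏ k ∈ Finset.Icc 1 n, (z + ((n : ℂ) + 1) / ((n : ℂ) + 2 - (k : ℂ)))) ∧
      Integrable (fun ω => ∑ k, (Trading.rank (fun k => p k ω) k (g ω k) : ℝ)) P ∧
      ∫ ω, ∑ k, (Trading.rank (fun k => p k ω) k (g ω k) : ℝ) ∂P =
        ((n : ℝ) + 1) * (harmonic n : ℝ) - (n : ℝ) := by
  refine ⟨fun q => Trading.existsUnique_isStable q, fun g hg => ?_⟩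
  obtain rfl : g = fun ω => Trading.stableAllocation fun k => p k ω :=
    funext fun ω => Trading.isStable_iff_eq.1 (hg ω)
  have h0 : (n.factorial : ℂ) ^ n ≠ 0 := pow_ne_zero _ (by exact_mod_cast n.factorial_ne_zero)
  have h0' : (n.factorial : ℝ) ^ n ≠ 0 := pow_ne_zero _ (by exact_mod_cast n.factorial_ne_zero)
  refine ⟨fun z => ?_, ?_⟩
  · obtain ⟨hi, he⟩ := hp.integral_eq fun q =>
      ∏ k, (z + (Trading.rank q k (Trading.stableAllocation q k) : ℂ))
    refine ⟨hi, he.trans ?_⟩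
    rw [Trading.sum_prod_add_rank, Complex.real_smul]
    push_cast
    rw [inv_mul_cancel_left₀ h0]
  · obtain ⟨hi, he⟩ := hp.integral_eq fun q =>
      ∑ k, (Trading.rank q k (Trading.stableAllocation q k) : ℝ)
    refine ⟨hi, he.trans ?_⟩
    have hs : ∑ q : Trading.Preferences n,
        ∑ k, (Trading.rank q k (Trading.stableAllocation q k) : ℝ) =
        (n.factorial : ℝ) ^ n * ∑ k ∈ Finset.Icc 1 n, ((n : ℝ) + 1) / (n + 2 - k) := by
      exact_mod_cast Trading.sum_sum_rank (n := n)
    rw [hs, smul_eq_mul, inv_mul_cancel_left₀ h0', Trading.sum_Icc_div_eq_harmonic]
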